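/- Let $p$ be a prime, let $a\ge 1$ be an integer with $p^a\equiv 1 \pmod 4$, and let $\mathrm{Paley}(p^a)$ be the Paley graph: its vertex set is the finite field $\mathrm{GF}(p^a)$, and two vertices $x,y$ are adjacent if and only if $y-x$ is a nonzero square. Let $G_0$ be the stabilizer of the vertex $0$ in the automorphism group of $\mathrm{Paley}(p^a)$, and let $$\mathcal T_4(\mathrm{Paley}(p^a))=\{M\in M_{\mathrm{GF}(p^a)}(\mathbb C) : M_{\sigma(x),\sigma(y)}=M_{x,y}\text{ for all }\sigma\in G_0\text{ and all }x,y\in \mathrm{GF}(p^a)\}$$ be the centralizer algebra with respect to the base vertex $0$, a subalgebra of the algebra of complex matrices with rows and columns indexed by $\mathrm{GF}(p^a)$. Then $$\dim_{\mathbb C}\mathcal T_4(\mathrm{Paley}(p^a))\le 2p^a+3.$$ If $a=1$, then equality holds, $\dim_{\mathbb C}\mathcal T_4(\mathrm{Paley}(p))=2p+3$, and there is an isomorphism of $\mathbb C$-algebras $$\mathcal T_4(\mathrm{Paley}(p))\cong M_3(\mathbb C)\oplus\bigoplus_{i=1}^{(p-3)/2}M_2(\mathbb C).$$ -/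

import Mathlib

/-- The Paley graph on a finite field `F` with `|F| ≡ 1 (mod 4)`: the vertices are the elements of
`F`, and `x`, `y` are adjacent exactly when `y - x` is a nonzero square. -/
def paleyGraph (F : Type*) [Field F] [Fintype F] (hF : Fintype.card F % 4 = 1) :
    SimpleGraph F where
  Adj x y := x ≠ y ∧ IsSquare (y - x)
  symm := by
    refine ⟨fun x y h => ⟨h.1.symm, ?_⟩⟩
    have h1 : IsSquare (-1 : F) := by
      rw [FiniteField.isSquare_neg_one_iff]
      omega
    have h2 := h1.mul h.2
    rwa [neg_one_mul, neg_sub] at h2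
  loopless := ⟨fun x h => h.1 rfl⟩

/-- The centralizer algebra `T₄(Γ, x₀)`: the complex matrices indexed by the vertices that are
fixed by every automorphism `σ` of the graph `Γ` with `σ x₀ = x₀`, where an automorphism acts on
matrices by permuting rows and columns simultaneously. -/
def centralizerAlgebra {X : Type*} [Fintype X] [DecidableEq X] (Γ : SimpleGraph X) (x₀ : X) :
    Subalgebra ℂ (Matrix X X ℂ) where
  carrier := {M | ∀ σ : Γ ≃g Γ, σ x₀ = x₀ → M.submatrix σ σ = M}
  mul_mem' := by
    intro M N hM hN σ hσ
    have h := Matrix.submatrix_mul_equiv M N (⇑σ) σ.toEquiv (⇑σ)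
    have e : (⇑σ.toEquiv : X → X) = ⇑σ := rfl
    rw [e, hM σ hσ, hN σ hσ] at h
    exact h.symm
  add_mem' := by
    intro M N hM hN σ hσ
    rw [Matrix.submatrix_add, Pi.add_apply, Pi.add_apply, hM σ hσ, hN σ hσ]
  algebraMap_mem' := by
    intro c σ _
    ext x y
    simp [Matrix.algebraMap_matrix_apply]

/-! Write `q` for the order of the field. Multiplications by nonzero squares are automorphisms
fixing `0`, so the centralizer algebra lies in their commutant, `squareCommutant`. The constant
function `1` and the `q - 1` powers of a generating multiplicative character `χ` form a basis of the
functions that diagonalizes them. On squares, `χ ^ k` and `χ ^ (k + (q - 1) / 2)` agree, and both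
the constant function and `χ ^ 0` give the trivial eigenvalue. So the eigenspaces have dimension 3
once and 2 exactly `(q - 3) / 2` times, and the commutant has dimension `9 + 4 * (q - 3) / 2 = 2 * q
+ 3`.

For prime `q` nothing is lost. An automorphism `σ` has only nonzero squares as difference quotients,
so `σ x - c * x` is injective for each of the more than `(q - 1) / 2` values of `c` that are zero or
nonsquare. A power sum argument then makes `σ` affine
(`FiniteField.eq_affine_of_injective_sub_mul`), and `σ 0 = 0` leaves only multiplication by a
square. -/

/-! ### Power sums and functions with few directions -/

/-- Over a finite field, the values of a polynomial of degree `q - 1` sum to minus its leading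
coefficient. -/
theorem FiniteField.sum_eval_of_natDegree_eq {K : Type*} [Field K] [Fintype K]
    (P : Polynomial K) (hP : P.natDegree = Fintype.card K - 1) :
    ∑ x : K, P.eval x = -P.leadingCoeff := by
  classical
  have hq : 0 < Fintype.card K - 1 := Nat.sub_pos_of_lt Fintype.one_lt_card
  simp_rw [Polynomial.eval_eq_sum_range]
  rw [Finset.sum_comm]
  simp_rw [← Finset.mul_sum]
  rw [Finset.sum_range_succ, Finset.sum_eq_zero, zero_add, Polynomial.coeff_natDegree, hP]
  · have h := FiniteField.sum_pow_units K (Fintype.card K - 1)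
    rw [if_pos dvd_rfl] at h
    rw [← Finset.sum_erase_add _ _ (Finset.mem_univ (0 : K)), zero_pow hq.ne', add_zero]
    have h2 : ∑ x ∈ Finset.univ.erase (0 : K), x ^ (Fintype.card K - 1) = -1 := by
      rw [← h]
      refine (Finset.sum_bij (fun (u : Kˣ) _ => (u : K)) ?_ ?_ ?_ ?_).symm
      · intro u _; simp
      · intro u _ v _ huv; exact Units.ext huv
      · intro b hb
        exact ⟨Units.mk0 b (Finset.ne_of_mem_erase hb), Finset.mem_univ _, rfl⟩
      · intro u _; rfl
    rw [h2, mul_neg_one]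
  · intro i hi
    rw [FiniteField.sum_pow_lt_card_sub_one K i (hP ▸ Finset.mem_range.mp hi), mul_zero]

/-- If `x ↦ f x - c x` is injective for more than `k` values of `c`, then all the mixed power sums
of `x` and `f x` of total degree `k` vanish. -/
theorem FiniteField.sum_pow_mul_pow_eq_zero {K : Type*} [Field K] [Fintype K]
    (f : K → K) (C : Finset K) (hC : ∀ c ∈ C, Function.Injective fun x => f x - c * x)
    {k : ℕ} (hk : k < C.card) (hkq : k < Fintype.card K - 1) {i : ℕ} (hi : i ≤ k)
    (hchoose : (k.choose i : K) ≠ 0) :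
    ∑ x, x ^ i * f x ^ (k - i) = 0 := by
  classical
  -- In the variable `c` this is `∑ x, (f x - c * x) ^ k`. For `c ∈ C` the base runs through the
  -- whole field, so the sum vanishes as `k < q - 1`. That is more roots than the degree allows, so
  -- every coefficient is zero.
  set Q : Polynomial K :=
    ∑ x, (Polynomial.C (-x) * Polynomial.X + Polynomial.C (f x)) ^ k with hQ
  have hdeg : Q.degree < C.card := by
    have h1 : Q.natDegree ≤ k := by
      refine Polynomial.natDegree_sum_le_of_forall_le _ _ fun x _ => ?_
      exact (Polynomial.natDegree_pow_le_of_le k Polynomial.natDegree_linear_le).trans (by simp)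
    exact (Polynomial.degree_le_of_natDegree_le h1).trans_lt (by exact_mod_cast hk)
  have hQ0 : Q = 0 := by
    refine Polynomial.eq_zero_of_degree_lt_of_eval_finset_eq_zero C hdeg fun c hc => ?_
    rw [hQ, Polynomial.eval_finsetSum]
    have hb : Function.Bijective fun x => f x - c * x :=
      Finite.injective_iff_bijective.mp (hC c hc)
    rw [← FiniteField.sum_pow_lt_card_sub_one K k hkq, ← hb.sum_comp (fun y => y ^ k)]
    refine Finset.sum_congr rfl fun x _ => ?_
    simp only [Polynomial.eval_pow, Polynomial.eval_add, Polynomial.eval_mul, Polynomial.eval_C,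
      Polynomial.eval_X]
    ring
  have hcoeff : Q.coeff i = (-1) ^ i * (k.choose i) * ∑ x, x ^ i * f x ^ (k - i) := by
    rw [hQ, Polynomial.finsetSum_coeff, Finset.mul_sum]
    refine Finset.sum_congr rfl fun x _ => ?_
    rw [add_pow, Polynomial.finsetSum_coeff, Finset.sum_eq_single i]
    · rw [mul_pow, ← Polynomial.C_pow, ← Polynomial.C_pow, ← Polynomial.C_eq_natCast,
        Polynomial.coeff_mul_C, Polynomial.coeff_mul_C, Polynomial.coeff_C_mul,
        Polynomial.coeff_X_pow_self, neg_pow]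
      ring
    · intro b _ hbi
      rw [mul_pow, ← Polynomial.C_pow, ← Polynomial.C_pow, ← Polynomial.C_eq_natCast,
        Polynomial.coeff_mul_C, Polynomial.coeff_mul_C, Polynomial.coeff_C_mul,
        Polynomial.coeff_X_pow, if_neg (Ne.symm hbi)]
      simp
    · intro h
      exact absurd (Finset.mem_range.mpr (Nat.lt_succ_of_le hi)) h
  rw [hQ0, Polynomial.coeff_zero] at hcoeff
  exact (mul_eq_zero.mp hcoeff.symm).resolve_left
    (mul_ne_zero (pow_ne_zero _ (neg_ne_zero.mpr one_ne_zero)) hchoose)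

/-- A function on a field with `p = 2m + 1` elements, `p` prime, for which `x ↦ f x - c x` is
injective for more than `m` values of `c` is affine. -/
theorem FiniteField.eq_affine_of_injective_sub_mul {K : Type*} [Field K] [Fintype K] {m : ℕ}
    (hp : (2 * m + 1).Prime) (hcard : Fintype.card K = 2 * m + 1) (f : K → K) (C : Finset K)
    (hC : ∀ c ∈ C, Function.Injective fun x => f x - c * x) (hm : m < C.card) :
    ∃ a b : K, ∀ x, f x = a * x + b := by
  classical
  have : Fact (2 * m + 1).Prime := ⟨hp⟩
  have : CharP K (2 * m + 1) := charP_of_card_eq_prime hcard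
  have hm0 : 0 < m := by
    rcases Nat.eq_zero_or_pos m with rfl | h
    · exact absurd hp (by norm_num)
    · exact h
  have hsum : ∀ i j, i + j ≤ m → ∑ x, x ^ i * f x ^ j = 0 := by
    intro i j hij
    have h := FiniteField.sum_pow_mul_pow_eq_zero f C hC (k := i + j) (i := i) (by omega)
      (by omega) (by omega) (by
        rw [Ne, CharP.cast_eq_zero_iff K (2 * m + 1)]
        intro hd
        have h : (i + j).choose i ∣ (i + j).factorial := by
          rw [← Nat.add_choose_mul_factorial_mul_factorial i j, mul_assoc, Nat.choose_symm_add]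
          exact dvd_mul_right _ _
        have := hp.dvd_factorial.mp (hd.trans h)
        omega)
    simpa using h
  set P := Lagrange.interpolate Finset.univ id f with hP
  have hinj : Set.InjOn (id : K → K) (Finset.univ : Finset K) := Function.injective_id.injOn
  have hev : ∀ x, P.eval x = f x := fun x =>
    Lagrange.eval_interpolate_at_node f hinj (Finset.mem_univ x)
  have hdeg : P.degree < (2 * m + 1 : ℕ) := by
    have := Lagrange.degree_interpolate_lt f hinj
    rwa [Finset.card_univ, hcard] at this
  have hle : P.natDegree ≤ 1 := by
    by_contra! hd
    have hP0 : P ≠ 0 := by rintro h; simp [h] at hd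
    have hd2 : P.natDegree < 2 * m + 1 := (Polynomial.natDegree_lt_iff_degree_lt hP0).mpr hdeg
    set d := P.natDegree with hdd
    -- With `2 * m = d * j + i`, the polynomial `X ^ i * P ^ j` has degree exactly `q - 1`, so its
    -- values have nonzero sum. But `d ≥ 2` forces `i + j ≤ m`, where the mixed power sums vanish.
    have hdiv : d * (2 * m / d) + 2 * m % d = 2 * m := Nat.div_add_mod _ _
    have hmod : 2 * m % d < d := Nat.mod_lt _ (by omega)
    generalize 2 * m / d = j at hdiv
    generalize 2 * m % d = i at hdiv hmod
    have hij : i + j ≤ m := by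
      rcases lt_or_ge j 2 with hj | hj
      · interval_cases j <;> omega
      · rcases Nat.lt_or_ge d 3 with h3 | h3
        · have : d = 2 := by omega
          rw [this] at hdiv hmod
          omega
        · obtain ⟨e, he⟩ := Nat.exists_eq_add_of_le h3
          obtain ⟨j', hj'⟩ := Nat.exists_eq_add_of_le hj
          rw [he, hj'] at hdiv
          have : 0 ≤ e * j' := Nat.zero_le _
          rw [he] at hmod
          nlinarith
    have hsum0 := hsum i j hij
    have hnd : (Polynomial.X ^ i * P ^ j).natDegree = Fintype.card K - 1 := by
      rw [Polynomial.natDegree_mul (pow_ne_zero _ Polynomial.X_ne_zero) (pow_ne_zero _ hP0),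
        Polynomial.natDegree_X_pow, Polynomial.natDegree_pow, hcard, ← hdd]
      rw [mul_comm] at hdiv
      omega
    have h := FiniteField.sum_eval_of_natDegree_eq _ hnd
    simp only [Polynomial.eval_mul, Polynomial.eval_pow, Polynomial.eval_X, hev, hsum0] at h
    exact mul_ne_zero (pow_ne_zero i Polynomial.X_ne_zero) (pow_ne_zero j hP0)
      (Polynomial.leadingCoeff_eq_zero.mp (neg_eq_zero.mp h.symm))
  refine ⟨P.coeff 1, P.coeff 0, fun x => ?_⟩
  rw [← hev]
  conv_lhs => rw [Polynomial.eq_X_add_C_of_natDegree_le_one hle]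
  simp

/-! ### Automorphisms of the Paley graph fixing zero -/

/-- More than half of the elements of a finite field of odd order are zero or nonsquares. -/
theorem FiniteField.lt_card_zero_or_not_isSquare {K : Type*} [Field K] [Fintype K] [DecidableEq K]
    [DecidablePred (IsSquare : K → Prop)] {m : ℕ} (hcard : Fintype.card K = 2 * m + 1) :
    m < (Finset.univ.filter fun c : K => c = 0 ∨ ¬IsSquare c).card := by
  have hm0 : 0 < m := by
    have := Fintype.one_lt_card (α := K)
    omega
  -- Nonzero squares are roots of `c ^ m = 1`.
  have h1 : (Finset.univ.filter fun c : K => ¬(c = 0 ∨ ¬IsSquare c)).card ≤ m := by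
    refine (Finset.card_le_card ?_).trans
      ((Multiset.toFinset_card_le _).trans (Polynomial.card_nthRoots m (1 : K)))
    intro c hc
    simp only [Finset.mem_filter, Finset.mem_univ, true_and, not_or, not_not] at hc
    obtain ⟨h0, w, rfl⟩ := hc
    rw [Multiset.mem_toFinset, Polynomial.mem_nthRoots hm0, ← pow_two, ← pow_mul]
    have := FiniteField.pow_card_sub_one_eq_one w (by rintro rfl; simp at h0)
    rwa [hcard, Nat.add_sub_cancel] at this
  have h2 := Finset.card_filter_add_card_filter_not (s := (Finset.univ : Finset K))
    (fun c : K => c = 0 ∨ ¬IsSquare c)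
  rw [Finset.card_univ, hcard] at h2
  omega

/-- The automorphisms of the Paley graph of prime order that fix `0` are the multiplications by
nonzero squares. -/
theorem paleyGraph_iso_eq_sq_mul {F : Type*} [Field F] [Fintype F]
    (hF : Fintype.card F % 4 = 1) (hp : (Fintype.card F).Prime)
    (σ : paleyGraph F hF ≃g paleyGraph F hF) (hσ : σ 0 = 0) :
    ∃ w : F, w ≠ 0 ∧ ∀ x, σ x = w ^ 2 * x := by
  classical
  obtain ⟨m, hm⟩ : ∃ m, Fintype.card F = 2 * m + 1 := ⟨Fintype.card F / 2, by omega⟩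
  have hadj : ∀ x y, x ≠ y → (IsSquare (σ y - σ x) ↔ IsSquare (y - x)) := by
    intro x y hxy
    have h := σ.map_rel_iff' (a := x) (b := y)
    change (σ x ≠ σ y ∧ IsSquare (σ y - σ x)) ↔ (x ≠ y ∧ IsSquare (y - x)) at h
    have h' : σ x ≠ σ y := σ.injective.ne hxy
    tauto
  obtain ⟨a, b, hab⟩ := FiniteField.eq_affine_of_injective_sub_mul (hm ▸ hp) hm σ
    (Finset.univ.filter fun c : F => c = 0 ∨ ¬IsSquare c) (by
      intro c hc x y hxy
      simp only [Finset.mem_filter, Finset.mem_univ, true_and] at hc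
      by_contra hne
      have h1 : σ y - σ x = c * (y - x) := by linear_combination -hxy
      rcases hc with rfl | hc
      · rw [zero_mul, sub_eq_zero] at h1
        exact hne (σ.injective h1.symm)
      · have hyx : y - x ≠ 0 := sub_ne_zero.mpr (Ne.symm hne)
        have hns : ∀ x y : F, x ≠ y → σ y - σ x = c * (y - x) → ¬IsSquare (y - x) := by
          intro x y hxy h hs
          have h2 := (hadj x y hxy).mpr hs
          have h3 := h2.div hs
          rw [h, mul_div_cancel_right₀ _ (sub_ne_zero.mpr (Ne.symm hxy))] at h3
          exact hc h3
        have hns1 := hns x y hne h1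
        have hns2 : ¬IsSquare (σ y - σ x) := fun h => hns1 ((hadj x y hne).mp h)
        -- A product of two nonsquares is a square, so the quotient `c` would be one too.
        have hdiv : IsSquare ((σ y - σ x) * (y - x)) := by
          have h0 : σ y - σ x ≠ 0 := sub_ne_zero.mpr (σ.injective.ne (Ne.symm hne))
          rw [← quadraticChar_one_iff_isSquare (mul_ne_zero h0 hyx), map_mul,
            quadraticChar_neg_one_iff_not_isSquare.mpr hns1,
            quadraticChar_neg_one_iff_not_isSquare.mpr hns2]
          norm_num
        have h3 := hdiv.div (IsSquare.mul_self (y - x))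
        rw [h1] at h3
        rw [mul_assoc, mul_div_cancel_right₀ _ (mul_ne_zero hyx hyx)] at h3
        exact hc h3)
    (FiniteField.lt_card_zero_or_not_isSquare hm)
  have hb : b = 0 := by simpa [hσ] using (hab 0).symm
  subst hb
  have ha : IsSquare a := by
    have := (hadj 0 1 zero_ne_one).mpr (by simp)
    simpa [hab] using this
  obtain ⟨w, rfl⟩ := ha
  refine ⟨w, ?_, fun x => by rw [hab]; ring⟩
  rintro rfl
  have := hab 1
  rw [zero_mul, zero_mul, zero_add, ← hσ] at this
  exact one_ne_zero (σ.injective this)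

/-! ### The commutant of the squares -/

/-- The algebra of matrices indexed by a finite field that are invariant under the multiplications
by nonzero squares. -/
def squareCommutant (F : Type*) [Field F] [Fintype F] [DecidableEq F] :
    Subalgebra ℂ (Matrix F F ℂ) where
  carrier := {M | ∀ w x y : F, w ≠ 0 → M (w ^ 2 * x) (w ^ 2 * y) = M x y}
  mul_mem' := by
    intro M N hM hN w x y hw
    have hb : Function.Bijective fun z : F => w ^ 2 * z := mulLeft_bijective₀ _ (pow_ne_zero 2 hw)
    rw [Matrix.mul_apply, Matrix.mul_apply, ← hb.sum_comp]
    exact Finset.sum_congr rfl fun z _ => by rw [hM w x z hw, hN w z y hw]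
  add_mem' := by
    intro M N hM hN w x y hw
    rw [Matrix.add_apply, Matrix.add_apply, hM w x y hw, hN w x y hw]
  algebraMap_mem' := by
    intro c w x y hw
    simp [Matrix.algebraMap_matrix_apply, hw]

theorem mem_squareCommutant {F : Type*} [Field F] [Fintype F] [DecidableEq F]
    {M : Matrix F F ℂ} :
    M ∈ squareCommutant F ↔ ∀ w x y : F, w ≠ 0 → M (w ^ 2 * x) (w ^ 2 * y) = M x y :=
  Iff.rfl

theorem centralizerAlgebra_paleyGraph_le {F : Type*} [Field F] [Fintype F] [DecidableEq F]
    (hF : Fintype.card F % 4 = 1) :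
    centralizerAlgebra (paleyGraph F hF) 0 ≤ squareCommutant F := by
  intro M hM w x y hw
  have hw2 : w ^ 2 ≠ 0 := pow_ne_zero 2 hw
  let σ : paleyGraph F hF ≃g paleyGraph F hF :=
    { toEquiv := Equiv.mulLeft₀ (w ^ 2) hw2
      map_rel_iff' := by
        intro x y
        change (w ^ 2 * x ≠ w ^ 2 * y ∧ IsSquare (w ^ 2 * y - w ^ 2 * x)) ↔
          (x ≠ y ∧ IsSquare (y - x))
        rw [← mul_sub, (mul_right_injective₀ hw2).ne_iff]
        refine and_congr_right fun _ => ⟨fun h => ?_, fun h => (IsSquare.sq w).mul h⟩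
        have h2 := h.div (IsSquare.sq w)
        rwa [mul_div_cancel_left₀ _ hw2] at h2 }
  exact congrFun (congrFun (hM σ (mul_zero _)) x) y

theorem centralizerAlgebra_paleyGraph_eq {F : Type*} [Field F] [Fintype F] [DecidableEq F]
    (hF : Fintype.card F % 4 = 1) (hp : (Fintype.card F).Prime) :
    centralizerAlgebra (paleyGraph F hF) 0 = squareCommutant F := by
  refine le_antisymm (centralizerAlgebra_paleyGraph_le hF) fun M hM σ hσ => ?_
  obtain ⟨w, hw, h⟩ := paleyGraph_iso_eq_sq_mul hF hp σ hσ
  ext x y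
  rw [Matrix.submatrix_apply, h, h]
  exact hM w x y hw

/-! ### Block diagonal matrices -/

/-- The block of an index of a block diagonal matrix with one block of size `3` and `n` blocks of
size `2`. -/
def blockIndex (n : ℕ) : Fin 3 ⊕ (Fin 2 × Fin n) → ℕ :=
  Sum.elim (fun _ => 0) fun rj => rj.2 + 1

/-- The embedding of the block diagonal matrices with one block of size `3` and `n` blocks of
size `2`. -/
def blockEmbedding (n : ℕ) :
    (Matrix (Fin 3) (Fin 3) ℂ × (Fin n → Matrix (Fin 2) (Fin 2) ℂ)) →ₐ[ℂ]
      Matrix (Fin 3 ⊕ (Fin 2 × Fin n)) (Fin 3 ⊕ (Fin 2 × Fin n)) ℂ :=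
  AlgHom.ofLinearMap
    { toFun := fun A => Matrix.fromBlocks A.1 0 0 (Matrix.blockDiagonal A.2)
      map_add' := fun A B => by simp [Matrix.fromBlocks_add]
      map_smul' := fun c A => by simp [Matrix.fromBlocks_smul] }
    (by simp)
    (fun A B => by
      have h : Matrix.blockDiagonal (A.2 * B.2) =
          Matrix.blockDiagonal A.2 * Matrix.blockDiagonal B.2 := Matrix.blockDiagonal_mul _ _
      simp [Matrix.fromBlocks_multiply, h])

theorem blockEmbedding_injective (n : ℕ) : Function.Injective (blockEmbedding n) := by
  rintro ⟨A, B⟩ ⟨A', B'⟩ h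
  have h' : Matrix.fromBlocks A 0 0 (Matrix.blockDiagonal B) =
    Matrix.fromBlocks A' 0 0 (Matrix.blockDiagonal B') := h
  rw [Matrix.fromBlocks_inj] at h'
  rw [h'.1, Matrix.blockDiagonal_injective h'.2.2.2]

theorem mem_range_blockEmbedding {n : ℕ}
    {N : Matrix (Fin 3 ⊕ (Fin 2 × Fin n)) (Fin 3 ⊕ (Fin 2 × Fin n)) ℂ} :
    N ∈ (blockEmbedding n).range ↔
      ∀ i j, blockIndex n i ≠ blockIndex n j → N i j = 0 := by
  constructor
  · rintro ⟨A, rfl⟩ i j hij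
    change Matrix.fromBlocks A.1 0 0 (Matrix.blockDiagonal A.2) i j = 0
    rcases i with i | ⟨r, i⟩ <;> rcases j with j | ⟨s, j⟩
    · exact absurd rfl hij
    · rfl
    · rfl
    · rw [Matrix.fromBlocks_apply₂₂]
      refine Matrix.blockDiagonal_apply_ne _ _ _ fun h => hij ?_
      simp [blockIndex, h]
  · intro h
    refine ⟨(N.toBlocks₁₁, Matrix.blockDiag N.toBlocks₂₂), ?_⟩
    change Matrix.fromBlocks N.toBlocks₁₁ 0 0
      (Matrix.blockDiagonal (Matrix.blockDiag N.toBlocks₂₂)) = N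
    ext i j
    rcases i with i | ⟨r, i⟩ <;> rcases j with j | ⟨s, j⟩
    · rfl
    · exact (h _ _ (by simp [blockIndex])).symm
    · exact (h _ _ (by simp [blockIndex])).symm
    · rw [Matrix.fromBlocks_apply₂₂, Matrix.blockDiagonal_apply]
      split_ifs with hij
      · cases hij; rfl
      · exact (h _ _ (by simpa [blockIndex, Fin.ext_iff] using hij)).symm

/-! ### Diagonalization by multiplicative characters -/

/-- Some basis of the functions on a finite field of odd order `2n + 3` diagonalizes the
multiplications by nonzero squares; it consists of multiplicative functions. -/
theorem exists_basis_sq_mul {F : Type*} [Field F] [Fintype F] [DecidableEq F] {n : ℕ}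
    (hn : Fintype.card F = 2 * n + 3) :
    ∃ (b : Module.Basis (Fin 3 ⊕ (Fin 2 × Fin n)) ℂ (F → ℂ)) (χ : MulChar F ℂ),
      orderOf χ = 2 * (n + 1) ∧
      ∀ i w x, w ≠ 0 → b i (w ^ 2 * x) = (χ ^ (2 * blockIndex n i)) w * b i x := by
  have hu : Fintype.card Fˣ = 2 * (n + 1) := by
    rw [Fintype.card_units, hn]; omega
  obtain ⟨χ, hχ⟩ := MulChar.exists_mulChar_orderOf_eq_card_units F
    (Complex.isPrimitiveRoot_exp (Fintype.card Fˣ) Fintype.card_ne_zero)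
  rw [hu] at hχ
  have hpow : χ ^ (2 * (n + 1)) = 1 := hχ ▸ pow_orderOf_eq_one χ
  -- Exponents of `χ`, paired so that partners differ by `n + 1`, half the order of `χ`, and hence
  -- agree on squares.
  let k : Fin 2 ⊕ (Fin 2 × Fin n) → ℕ :=
    Sum.elim (fun r => r * (n + 1)) fun rj => rj.2 + 1 + rj.1 * (n + 1)
  have hk : ∀ i, k i < 2 * (n + 1) := by
    rintro (r | ⟨r, j⟩)
    · fin_cases r <;> simp [k]
    · have := j.2
      fin_cases r <;> simp [k] <;> omega
  have hkinj : Function.Injective k := by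
    rintro (r | ⟨r, i⟩) (s | ⟨s, j⟩) h
    · fin_cases r <;> fin_cases s <;> simp [k] at h ⊢
    · have := j.2
      fin_cases r <;> fin_cases s <;> simp [k] at h ⊢ <;> omega
    · have := i.2
      fin_cases r <;> fin_cases s <;> simp [k] at h ⊢ <;> omega
    · have := i.2
      have := j.2
      fin_cases r <;> fin_cases s <;> simp [k, Fin.ext_iff] at h ⊢ <;> omega
  let g : Fin 2 ⊕ (Fin 2 × Fin n) → (F →* ℂ) := fun i => (χ ^ k i).toMonoidHom
  have hg0 : ∀ i, g i 0 = 0 := fun i => MulChar.map_zero (χ ^ k i)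
  have hginj : Function.Injective g := by
    intro i j hij
    refine hkinj (pow_injOn_Iio_orderOf (x := χ) (hχ ▸ hk i) (hχ ▸ hk j) ?_)
    exact MulChar.ext' fun x => DFunLike.congr_fun hij x
  -- The first of the three is the constant `1`; it differs from `χ ^ 0`, which vanishes at `0`.
  let e : Fin 3 ⊕ (Fin 2 × Fin n) → (F →* ℂ) :=
    Sum.elim (Fin.cases 1 fun r => g (Sum.inl r)) fun rj => g (Sum.inr rj)
  have hne : ∀ i, g i ≠ 1 := fun i h => by
    have := DFunLike.congr_fun h 0
    rw [hg0] at this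
    exact zero_ne_one this
  have heinj : Function.Injective e := by
    rintro (r | i) (s | j) h
    · refine Fin.cases (fun h => ?_) (fun r h => ?_) r h
      · refine Fin.cases (fun _ => rfl) (fun s h => ?_) s h
        exact absurd h.symm (hne _)
      · revert h
        refine Fin.cases (fun h => ?_) (fun s h => ?_) s
        · exact absurd h (hne _)
        · exact congrArg (fun t : Fin 2 => Sum.inl t.succ) (Sum.inl_injective (hginj h))
    · revert h
      refine Fin.cases (fun h => ?_) (fun s h => ?_) r
      · exact absurd h.symm (hne _)
      · exact absurd (hginj h) (by simp)
    · revert h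
      refine Fin.cases (fun h => ?_) (fun s h => ?_) s
      · exact absurd h (hne _)
      · exact absurd (hginj h) (by simp)
    · rw [Sum.inr_injective (hginj h)]
  have hli : LinearIndependent ℂ fun i => (e i : F → ℂ) :=
    (linearIndependent_monoidHom F ℂ).comp e heinj
  refine ⟨basisOfLinearIndependentOfCardEqFinrank hli ?_, χ, hχ, fun i w x hw => ?_⟩
  · simp [hn]; ring
  · rw [coe_basisOfLinearIndependentOfCardEqFinrank, map_mul]
    congr 1
    have hpw : ∀ l : ℕ, (χ ^ l) (w ^ 2) = (χ ^ (2 * l)) w := by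
      intro l
      rw [map_pow, mul_comm, pow_mul, MulChar.pow_apply' _ two_ne_zero]
    have h1 : (χ ^ 0) w = 1 := by rw [pow_zero, MulChar.one_apply hw.isUnit]
    rcases i with r | ⟨r, j⟩
    · fin_cases r
      · exact h1.symm
      · exact (hpw (0 * (n + 1))).trans (by rw [zero_mul]; rfl)
      · exact (hpw (1 * (n + 1))).trans (by rw [one_mul, hpow, ← pow_zero χ]; rfl)
    · refine (hpw (j + 1 + r * (n + 1))).trans ?_
      have : 2 * ((j : ℕ) + 1 + r * (n + 1)) = 2 * (j + 1) + 2 * (n + 1) * r := by ring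
      rw [this, pow_add, pow_mul χ (2 * (n + 1)), hpow, one_pow, mul_one]
      rfl

/-- An endomorphism commutes with one that a basis diagonalizes if and only if its matrix in that
basis vanishes between different eigenvalues. -/
theorem commute_iff_toMatrixAlgEquiv_eq_zero {R V ι : Type*} [Field R] [AddCommGroup V]
    [Module R V] [Fintype ι] [DecidableEq ι] (b : Module.Basis ι R V) (φ L : V →ₗ[R] V)
    (d : ι → R) (hd : ∀ i, φ (b i) = d i • b i) :
    L ∘ₗ φ = φ ∘ₗ L ↔ ∀ i j, d i ≠ d j → LinearMap.toMatrixAlgEquiv b L i j = 0 := by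
  have hrepr : ∀ v i, b.repr (φ v) i = d i * b.repr v i := by
    intro v i
    have h : b.coord i ∘ₗ φ = d i • b.coord i := by
      refine b.ext fun j => ?_
      simp only [LinearMap.comp_apply, hd, map_smul, LinearMap.smul_apply, Module.Basis.coord_apply,
        Module.Basis.repr_self, smul_eq_mul, Finsupp.single_apply]
      split_ifs with hij
      · rw [hij]
      · simp
    exact LinearMap.congr_fun h v
  have h1 : L ∘ₗ φ = φ ∘ₗ L ↔ ∀ i j, (d j - d i) * LinearMap.toMatrixAlgEquiv b L i j = 0 := by
    constructor
    · intro h i j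
      have h2 := congrArg (fun v => b.repr v i) (LinearMap.congr_fun h (b j))
      simp only [LinearMap.comp_apply, hd, map_smul, hrepr, Finsupp.smul_apply, smul_eq_mul] at h2
      rw [LinearMap.toMatrixAlgEquiv_apply, sub_mul, h2, sub_self]
    · intro h
      refine b.ext fun j => b.ext_elem fun i => ?_
      have h2 := h i j
      rw [LinearMap.toMatrixAlgEquiv_apply, sub_mul, sub_eq_zero] at h2
      simpa only [LinearMap.comp_apply, hd, map_smul, hrepr, Finsupp.smul_apply, smul_eq_mul]
        using h2
  rw [h1]
  refine forall₂_congr fun i j => ?_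
  rw [mul_eq_zero, sub_eq_zero, eq_comm (a := d j)]
  tauto

/-- Turns invariance of entries into commutation of operators, which can be tested in an eigenbasis.
-/
theorem mem_squareCommutant_iff_commute {F : Type*} [Field F] [Fintype F] [DecidableEq F]
    {M : Matrix F F ℂ} :
    M ∈ squareCommutant F ↔ ∀ w : F, w ≠ 0 →
      Matrix.toLinAlgEquiv' M ∘ₗ LinearMap.funLeft ℂ ℂ (w ^ 2 * ·) =
        LinearMap.funLeft ℂ ℂ (w ^ 2 * ·) ∘ₗ Matrix.toLinAlgEquiv' M := by
  rw [mem_squareCommutant]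
  constructor
  · intro hM w hw
    have hb : Function.Bijective fun z : F => w ^ 2 * z := mulLeft_bijective₀ _ (pow_ne_zero 2 hw)
    refine LinearMap.ext fun v => funext fun x => ?_
    change ∑ y, M x y * v (w ^ 2 * y) = ∑ y, M (w ^ 2 * x) y * v y
    rw [← hb.sum_comp fun y => M (w ^ 2 * x) y * v y]
    exact Finset.sum_congr rfl fun y _ => by rw [hM w x y hw]
  · intro h w x y hw
    have hinj := mul_right_injective₀ (pow_ne_zero 2 hw)
    have h2 : ∑ z, M x z * (Pi.single (w ^ 2 * y) 1 : F → ℂ) (w ^ 2 * z) =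
        ∑ z, M (w ^ 2 * x) z * (Pi.single (w ^ 2 * y) 1 : F → ℂ) z :=
      congrFun (LinearMap.congr_fun (h w hw) (Pi.single (w ^ 2 * y) 1)) x
    simpa [Pi.single_apply, hinj.eq_iff] using h2.symm

theorem nonempty_squareCommutant_algEquiv {F : Type*} [Field F] [Fintype F] [DecidableEq F]
    {n : ℕ} (hn : Fintype.card F = 2 * n + 3) :
    Nonempty (squareCommutant F ≃ₐ[ℂ]
      (Matrix (Fin 3) (Fin 3) ℂ × (Fin n → Matrix (Fin 2) (Fin 2) ℂ))) := by
  obtain ⟨b, χ, hχ, hb⟩ := exists_basis_sq_mul hn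
  let ψ := Matrix.toLinAlgEquiv'.trans (LinearMap.toMatrixAlgEquiv b)
  let φ := ψ.symm.toAlgHom.comp (blockEmbedding n)
  have hφ : Function.Injective φ := ψ.symm.injective.comp (blockEmbedding_injective n)
  -- Below the order of `χ`, distinct exponents give distinct characters, so some `w` separates any
  -- two blocks.
  have hlt : ∀ i, 2 * blockIndex n i < orderOf χ := by
    rw [hχ]
    rintro (r | ⟨r, j⟩)
    · simp [blockIndex]
    · have := j.2
      simp only [blockIndex, Sum.elim_inr]
      omega
  have hrange : squareCommutant F = φ.range := by
    ext M
    have h1 : M ∈ φ.range ↔ ψ M ∈ (blockEmbedding n).range := by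
      constructor
      · rintro ⟨A, rfl⟩
        exact ⟨A, (ψ.apply_symm_apply _).symm⟩
      · rintro ⟨A, hA⟩
        exact ⟨A, (congrArg ψ.symm hA).trans (ψ.symm_apply_apply M)⟩
    have h2 := fun (w : F) (hw : w ≠ 0) => commute_iff_toMatrixAlgEquiv_eq_zero b
      (LinearMap.funLeft ℂ ℂ (w ^ 2 * ·)) (Matrix.toLinAlgEquiv' M)
      (fun i => (χ ^ (2 * blockIndex n i)) w) (fun i => funext fun x => hb i w x hw)
    rw [h1, mem_range_blockEmbedding, mem_squareCommutant_iff_commute]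
    constructor
    · intro h i j hij
      by_contra hN
      have h3 : χ ^ (2 * blockIndex n i) = χ ^ (2 * blockIndex n j) := by
        refine MulChar.ext fun u => ?_
        by_contra hu
        exact hN ((h2 u u.ne_zero).mp (h u u.ne_zero) i j hu)
      have := pow_injOn_Iio_orderOf (hlt i) (hlt j) h3
      omega
    · intro h w hw
      refine (h2 w hw).mpr fun i j hij => h i j fun h' => hij ?_
      simp only [h']
  rw [hrange]
  exact ⟨(AlgEquiv.ofInjective φ hφ).symm⟩

theorem finrank_squareCommutant {F : Type*} [Field F] [Fintype F] [DecidableEq F]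
    {n : ℕ} (hn : Fintype.card F = 2 * n + 3) :
    Module.finrank ℂ (squareCommutant F) = 2 * Fintype.card F + 3 := by
  obtain ⟨e⟩ := nonempty_squareCommutant_algEquiv hn
  rw [e.toLinearEquiv.finrank_eq, Module.finrank_prod, Module.finrank_pi_fintype,
    Module.finrank_matrix, hn]
  simp [Module.finrank_matrix]
  ring

theorem mainTheorem7 (p a : ℕ) (hp : p.Prime) (F : Type*) [Field F] [Fintype F] [DecidableEq F]
    (hcard : Fintype.card F = p ^ a) (hF : Fintype.card F % 4 = 1) :
    Module.finrank ℂ (centralizerAlgebra (paleyGraph F hF) 0) ≤ 2 * p ^ a + 3 ∧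
    (a = 1 →
      Module.finrank ℂ (centralizerAlgebra (paleyGraph F hF) 0) = 2 * p + 3 ∧
      Nonempty (centralizerAlgebra (paleyGraph F hF) 0 ≃ₐ[ℂ]
        (Matrix (Fin 3) (Fin 3) ℂ × (Fin ((p - 3) / 2) → Matrix (Fin 2) (Fin 2) ℂ)))) := by
  obtain ⟨n, hn⟩ : ∃ n, Fintype.card F = 2 * n + 3 := by
    have := Fintype.one_lt_card (α := F)
    exact ⟨(Fintype.card F - 3) / 2, by omega⟩
  refine ⟨?_, ?_⟩
  · rw [← hcard, ← finrank_squareCommutant hn]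
    exact Submodule.finrank_mono (R := ℂ) (M := Matrix F F ℂ)
      (s := (centralizerAlgebra (paleyGraph F hF) 0).toSubmodule)
      (t := (squareCommutant F).toSubmodule) (centralizerAlgebra_paleyGraph_le hF)
  · rintro rfl
    rw [pow_one] at hcard
    have hp' : (Fintype.card F).Prime := hcard ▸ hp
    rw [centralizerAlgebra_paleyGraph_eq hF hp', ← hcard]
    refine ⟨finrank_squareCommutant hn, ?_⟩
    have : (Fintype.card F - 3) / 2 = n := by omega
    rw [this]
    exact nonempty_squareCommutant_algEquiv hn
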